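/- A frequency is a strictly increasing sequence $\omega=(\omega_n)_{n\in\mathbb N}$, $\mathbb N=\{1,2,\dots\}$, of non-negative real numbers with $\omega_n\to\infty$. For $x\in\mathbb N$ let $\mathcal H_\infty^{\le x}(\omega)$ be the complex Banach space of all Dirichlet polynomials $D(s)=\sum_{n=1}^{x}a_ne^{-\omega_ns}$, $a_n\in\mathbb C$, with the norm $\|D\|_\infty=\sup_{t\in\mathbb R}|D(it)|$. For a closed subspace $X$ of a Banach space $Y$ let $\boldsymbol\lambda(X,Y)=\inf\|P\|$, the infimum over all bounded linear projections $P$ of $Y$ onto $X$; the projection constant $\boldsymbol\lambda(X)$ of a complex Banach space $X$ is the supremum of $\boldsymbol\lambda(I(X),Y)$ over all complex Banach spaces $Y$ and all isometric linear embeddings $I\colon X\to Y$ with $I(X)$ complemented in $Y$. An $\omega$-Dirichlet group is a pair $(G,\beta)$ of a compact abelian group $G$ and a continuous homomorphism $\beta\colon\mathbb R\to G$ with dense range such that for every $n$ there is a (necessarily unique) character $h_{\omega_n}\in\widehat G$ with $h_{\omega_n}(\beta(t))=e^{-i\omega_nt}$ for all $t\in\mathbb R$. A set $E\subset\widehat G$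 is a $\Lambda(2)$-set if there is $C>0$ such that $\|P\|_{L_2(G)}\le C\|P\|_{L_1(G)}$ for every trigonometric polynomial $P\in\operatorname{span}E$, the norms being taken with respect to the normalized Haar measure; the least such $C$ is its $\Lambda(2)$-constant. A subset $E$ of an abelian group (written multiplicatively) is a $B_2$-set if, for all $\gamma_1,\dots,\gamma_4\in E$, $\gamma_1\gamma_2=\gamma_3\gamma_4$ holds if and only if $(\gamma_3,\gamma_4)$ is a permutation of $(\gamma_1,\gamma_2)$. **Theorem.** Let $\omega$ be a frequency and $(G,\beta)$ an $\omega$-Dirichlet group such that the characters $h_{\omega_n}$, $n\in\mathbb N$, form a $\Lambda(2)$-set with $\Lambda(2)$-constant $C_2(\omega)$. Then, for all $x\in\mathbb N$, $$\frac{1}{C_2(\omega)}\sqrt x\;\le\;\boldsymbol\lambda\big(\mathcal H_\infty^{\le x}(\omega)\big)\;\le\;\sqrt x .$$ In particular, if $\omega$ satisfies the $B_2$-condition, then, for all $x\in\mathbb N$, $$\frac{1}{\sqrt2}\sqrt x\;\le\;\boldsymbol\lambda\big(\mathcal H_\infty^{\le x}(\omega)\big)\;\le\;\sqrt x .$$ Here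 the $B_2$-condition means that the characters $h_{\omega_n}$ form a $B_2$-set in $\widehat G$ for some $\omega$-Dirichlet group $(G,\beta)$, or, equivalently, that $\{\omega_n : n\in\mathbb N\}$ is a $B_2$-set in the additive group $\mathbb R$; the bounds are asserted under either form of the condition. -/

import Mathlib

open scoped ENNReal BoundedContinuousFunction

/-! ## Projection constants of complex Banach spaces -/

/-- The relative projection constant `λ(X, Y)` of a subspace `X` of `Y`: the infimum of the norms
of all bounded linear projections of `Y` onto `X`, with `inf ∅ = ∞`. -/
noncomputable def relProjectionConstant {Y : Type*} [NormedAddCommGroup Y] [NormedSpace ℂ Y]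
    (X : Submodule ℂ Y) : ℝ≥0∞ :=
  ⨅ (P : Y →L[ℂ] X) (_ : ∀ x : X, P x = x), ‖P‖ₑ

/-- The absolute projection constant `λ(X)`: the supremum of `λ(I(X), Y)` over all Banach spaces
`Y` and all isometric embeddings `I : X → Y` with complemented range. The spaces `Y` range over
the universe of `X`; this universe contains `ℓ_∞(B)`, where `B` is the dual unit ball of `X`, and
since `ℓ_∞(B)` is isometrically injective, larger spaces do not change the supremum. -/
noncomputable def projectionConstant.{u} (X : Type u) [NormedAddCommGroup X] [NormedSpace ℂ X] :
    ℝ≥0∞ :=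
  ⨆ (Y : Type u) (_ : NormedAddCommGroup Y) (_ : NormedSpace ℂ Y) (_ : CompleteSpace Y)
    (I : X →ₗᵢ[ℂ] Y) (_ : (LinearMap.range I.toLinearMap).ClosedComplemented),
    relProjectionConstant (LinearMap.range I.toLinearMap)

/-! ## Frequencies and spaces of Dirichlet polynomials -/

/-- A frequency: a strictly increasing, non-negative real sequence `(ω_n)`, `n = 1, 2, …`,
tending to infinity. -/
structure IsFrequency (ω : ℕ+ → ℝ) : Prop where
  strictMono : StrictMono ω
  nonneg : ∀ n, 0 ≤ ω n
  tendsto : Filter.Tendsto ω Filter.atTop Filter.atTop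

/-- The vector space of all `ω`-Dirichlet polynomials `s ↦ ∑_{n ∈ J} a_n e^{-ω_n s}` supported on
`J`, as functions on `ℂ`. -/
noncomputable def dirichletPolynomials (ω : ℕ+ → ℝ) (J : Finset ℕ+) : Submodule ℂ (ℂ → ℂ) :=
  Submodule.span ℂ ((fun n : ℕ+ => fun s : ℂ => Complex.exp (-(ω n : ℂ) * s)) '' (J : Set ℕ+))

theorem dirichletPolynomials_differentiable {ω : ℕ+ → ℝ} {J : Finset ℕ+} {D : ℂ → ℂ}
    (hD : D ∈ dirichletPolynomials ω J) : Differentiable ℂ D := by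
  induction hD using Submodule.span_induction with
  | mem f hf =>
    obtain ⟨n, -, rfl⟩ := hf
    fun_prop
  | zero => exact differentiable_const 0
  | add f g _ _ hf hg => exact hf.add hg
  | smul c f _ hf => exact hf.const_smul c

theorem dirichletPolynomials_bounded {ω : ℕ+ → ℝ} {J : Finset ℕ+} {D : ℂ → ℂ}
    (hD : D ∈ dirichletPolynomials ω J) : ∃ C : ℝ, ∀ t : ℝ, ‖D (t * Complex.I)‖ ≤ C := by
  induction hD using Submodule.span_induction with
  | mem f hf =>
    obtain ⟨n, -, rfl⟩ := hf
    refine ⟨1, fun t => ?_⟩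
    simp [Complex.norm_exp]
  | zero => exact ⟨0, fun t => by simp⟩
  | add f g _ _ hf hg =>
    obtain ⟨a, ha⟩ := hf
    obtain ⟨b, hb⟩ := hg
    exact ⟨a + b, fun t => (norm_add_le _ _).trans (add_le_add (ha t) (hb t))⟩
  | smul c f _ hf =>
    obtain ⟨a, ha⟩ := hf
    refine ⟨‖c‖ * a, fun t => ?_⟩
    simpa using mul_le_mul_of_nonneg_left (ha t) (norm_nonneg c)

/-- The space `H_∞^J(ω)` of all `ω`-Dirichlet polynomials supported on `J`. It is a type of its own,
so that it carries only the norm defined below. -/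
def HInf (ω : ℕ+ → ℝ) (J : Finset ℕ+) : Type := dirichletPolynomials ω J

namespace HInf

variable {ω : ℕ+ → ℝ} {J : Finset ℕ+}

noncomputable instance : AddCommGroup (HInf ω J) :=
  inferInstanceAs (AddCommGroup (dirichletPolynomials ω J))

noncomputable instance : Module ℂ (HInf ω J) :=
  inferInstanceAs (Module ℂ (dirichletPolynomials ω J))

/-- The function on `ℂ` given by a Dirichlet polynomial. -/
def toFun (D : HInf ω J) : ℂ → ℂ := D.1

/-- Restriction of a Dirichlet polynomial to the imaginary axis, `t ↦ D(it)`. -/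
noncomputable def restrict (ω : ℕ+ → ℝ) (J : Finset ℕ+) : HInf ω J →ₗ[ℂ] (ℝ →ᵇ ℂ) where
  toFun D := BoundedContinuousFunction.ofNormedAddCommGroup
    (fun t : ℝ => D.toFun (t * Complex.I))
    ((dirichletPolynomials_differentiable D.2).continuous.comp (by fun_prop))
    (dirichletPolynomials_bounded D.2).choose (dirichletPolynomials_bounded D.2).choose_spec
  map_add' _ _ := rfl
  map_smul' _ _ := rfl

theorem restrict_apply (D : HInf ω J) (t : ℝ) : restrict ω J D t = D.toFun (t * Complex.I) := rfl

theorem restrict_injective (ω : ℕ+ → ℝ) (J : Finset ℕ+) :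
    Function.Injective (restrict ω J) := by
  refine (injective_iff_map_eq_zero _).2 fun D hD => ?_
  have hD' : ∀ t : ℝ, D.toFun (t * Complex.I) = 0 := fun t => by
    rw [← restrict_apply, hD]; rfl
  have hd : Differentiable ℂ D.toFun := dirichletPolynomials_differentiable D.2
  have ha : AnalyticOnNhd ℂ D.toFun Set.univ := fun z _ => hd.analyticAt z
  have hf : ∃ᶠ z in nhdsWithin (0 : ℂ) {0}ᶜ, D.toFun z = 0 := by
    have ht : Filter.Tendsto (fun t : ℝ => (t : ℂ) * Complex.I) (nhdsWithin 0 {0}ᶜ)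
        (nhdsWithin (0 : ℂ) {0}ᶜ) := by
      refine tendsto_nhdsWithin_iff.2 ⟨?_, ?_⟩
      · have hc : Continuous (fun t : ℝ => (t : ℂ) * Complex.I) := by fun_prop
        have := hc.tendsto 0
        simp only [Complex.ofReal_zero, zero_mul] at this
        exact this.mono_left nhdsWithin_le_nhds
      · filter_upwards [self_mem_nhdsWithin] with t h0
        simpa using h0
    exact ht.frequently (Filter.Frequently.of_forall hD')
  have hz := ha.eq_of_frequently_eq (g := fun _ => (0 : ℂ)) (fun z _ => analyticAt_const) hf
  exact Subtype.ext hz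

noncomputable instance : NormedAddCommGroup (HInf ω J) :=
  NormedAddCommGroup.induced (HInf ω J) (ℝ →ᵇ ℂ) (restrict ω J) (restrict_injective ω J)

noncomputable instance : NormedSpace ℂ (HInf ω J) :=
  NormedSpace.induced ℂ (HInf ω J) (ℝ →ᵇ ℂ) (restrict ω J)

/-- The norm on `H_∞^J(ω)` is the supremum norm on the imaginary axis. -/
theorem norm_def (D : HInf ω J) : ‖D‖ = ⨆ t : ℝ, ‖D.toFun (t * Complex.I)‖ :=
  BoundedContinuousFunction.norm_eq_iSup_norm (restrict ω J D)

end HInf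

/-- The space `H_∞^{≤ x}(ω)`, that is, `H_∞^J(ω)` with `J = {n : 1 ≤ n ≤ x}`. -/
abbrev HInfLE (ω : ℕ+ → ℝ) (x : ℕ+) : Type := HInf ω (Finset.Icc 1 x)

/-! ## Characters, `Λ(p)`-sets and `B₂`-sets -/

section Characters

variable {G : Type*} [CommGroup G] [TopologicalSpace G]

/-- A character of `G` as a continuous complex-valued function. -/
noncomputable def characterFun (γ : PontryaginDual G) : C(G, ℂ) where
  toFun a := (γ a : ℂ)
  continuous_toFun := continuous_induced_dom.comp (map_continuous γ)

/-- The space `Trig_E(G)` of all trigonometric polynomials on `G` supported on `E`. -/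
noncomputable def trigPolynomials (E : Set (PontryaginDual G)) : Submodule ℂ C(G, ℂ) :=
  Submodule.span ℂ (characterFun '' E)

variable [IsTopologicalGroup G] [CompactSpace G] [MeasurableSpace G] [BorelSpace G]

/-- The Haar probability measure of a compact group. -/
noncomputable def normalizedHaar (G : Type*) [CommGroup G] [TopologicalSpace G]
    [IsTopologicalGroup G] [CompactSpace G] [MeasurableSpace G] [BorelSpace G] :
    MeasureTheory.Measure G :=
  MeasureTheory.Measure.haarMeasure (⊤ : TopologicalSpace.PositiveCompacts G)

/-- The constants `C > 0` with `‖P‖_p ≤ C ‖P‖_1` for all trigonometric polynomials `P` supported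
on `E`. -/
def lambdaBounds (p : ℝ≥0∞) (E : Set (PontryaginDual G)) : Set ℝ :=
  {C | 0 < C ∧ ∀ P ∈ trigPolynomials E,
    MeasureTheory.eLpNorm (fun a => P a) p (normalizedHaar G) ≤
      ENNReal.ofReal C * MeasureTheory.eLpNorm (fun a => P a) 1 (normalizedHaar G)}

/-- `E` is a `Λ(p)`-set, for `1 < p < ∞`. -/
def IsLambdaSet (p : ℝ≥0∞) (E : Set (PontryaginDual G)) : Prop :=
  (lambdaBounds p E).Nonempty

/-- The `Λ(p)`-constant of `E`: the least constant in the defining inequality (for a non-empty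
`Λ(p)`-set `E` the infimum is attained and is at least `1`). -/
noncomputable def lambdaConstant (p : ℝ≥0∞) (E : Set (PontryaginDual G)) : ℝ :=
  sInf (lambdaBounds p E)

end Characters

/-- A subset `E` of an abelian group is a `B₂`-set if, for elements of `E`,
`γ₁γ₂ = γ₃γ₄` holds if and only if `(γ₃, γ₄)` is a permutation of `(γ₁, γ₂)`. -/
def IsB2Set {A : Type*} [CommGroup A] (E : Set A) : Prop :=
  ∀ γ₁ ∈ E, ∀ γ₂ ∈ E, ∀ γ₃ ∈ E, ∀ γ₄ ∈ E,
    γ₁ * γ₂ = γ₃ * γ₄ ↔ (γ₃ = γ₁ ∧ γ₄ = γ₂) ∨ (γ₃ = γ₂ ∧ γ₄ = γ₁)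

/-- The `B₂`-condition for a frequency: the set `{ω_n}` is a `B₂`-set in the additive group `ℝ`
(the dual group of `ℝ`), that is, `ω_i + ω_j = ω_k + ω_l` only if `{i, j} = {k, l}`. -/
def SatisfiesB2 (ω : ℕ+ → ℝ) : Prop :=
  IsB2Set (Set.range fun n => Multiplicative.ofAdd (ω n))

/-! ## `ω`-Dirichlet groups -/

/-- `(G, β)` is an `ω`-Dirichlet group: `β : ℝ → G` is a continuous homomorphism with dense range,
and every character `t ↦ e^{-iω_n t}` of `ℝ` factors as `h ∘ β` for a character `h` of `G`.
(`ℝ` with its addition is written as `Multiplicative ℝ`.) -/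
structure IsDirichletGroup (ω : ℕ+ → ℝ) {G : Type*} [CommGroup G] [TopologicalSpace G]
    (β : Multiplicative ℝ →ₜ* G) : Prop where
  denseRange : DenseRange β
  exists_char : ∀ n : ℕ+, ∃ h : PontryaginDual G,
    ∀ t : ℝ, h (β (Multiplicative.ofAdd t)) = Circle.exp (-(ω n * t))

namespace IsDirichletGroup

variable {ω : ℕ+ → ℝ} {G : Type*} [CommGroup G] [TopologicalSpace G]
  {β : Multiplicative ℝ →ₜ* G}

/-- The character `h_{ω_n}` of `G`. -/
noncomputable def char (hβ : IsDirichletGroup ω β) (n : ℕ+) : PontryaginDual G :=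
  (hβ.exists_char n).choose

theorem char_apply (hβ : IsDirichletGroup ω β) (n : ℕ+) (t : ℝ) :
    hβ.char n (β (Multiplicative.ofAdd t)) = Circle.exp (-(ω n * t)) :=
  (hβ.exists_char n).choose_spec t

/-- The character `h_{ω_n}` is determined by `e^{-iω_n t} = h_{ω_n}(β(t))`. -/
theorem char_unique (hβ : IsDirichletGroup ω β) (n : ℕ+) (h : PontryaginDual G)
    (hh : ∀ t : ℝ, h (β (Multiplicative.ofAdd t)) = Circle.exp (-(ω n * t))) :
    h = hβ.char n := by
  refine PontryaginDual.ext fun a => congrFun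
    (hβ.denseRange.equalizer (map_continuous h) (map_continuous (hβ.char n)) ?_) a
  funext t
  exact (hh t.toAdd).trans (hβ.char_apply n t.toAdd).symm

end IsDirichletGroup

/-! Upper bound. Let `I : X → Y` be an isometric embedding of the space `X` of Dirichlet polynomials
supported on `J`. The coefficient of `e^{-ω_n s}` in `D` is the limit of the averages over `k < N`
of `e^{iω_n kτ} D(ikτ)`, for a step `τ` that separates the frequencies in `J`. Extending the
evaluations at `ikτ` to `Y` by Hahn–Banach and taking an ultrafilter limit of the same averages
extends the coefficient functionals, hence yields a left inverse `Q` of `I`. The value `(Qy)(it)` is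
a limit of averages of the extended evaluations against the kernel `∑_{n ∈ J} e^{iω_n(kτ - t)}`. The
quadratic mean of this kernel tends to `√|J|`, so Cauchy–Schwarz gives `‖Q‖ ≤ √|J|`
(`exists_left_inverse`).

Lower bound. On a Dirichlet group `G`, density of `β(ℝ)` embeds `C(G)` isometrically into the
bounded continuous functions on `ℝ`, with the trigonometric polynomials in the `h_{ω_n}`, `n ∈ J`,
corresponding to `X`. A projection onto `X` thus induces a projection `R` of `C(G)` with no larger
norm. Averaging `R` over translations (Rudin's argument, `integral_average_projection`) leaves the
convolution with `u = ∑_{n ∈ J} h_{ω_n}`; testing it against an approximate sign of `u` gives `‖u‖₁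
≤ ‖R‖` (`integral_norm_le_of_duality`).

It remains to bound `‖u‖₁` from below, knowing `‖u‖₂ = √|J|`. For a `Λ(2)`-set this is the defining
inequality. For a `B₂`-set, `‖u‖₄⁴ ≤ 2|J|²`, and comparing the first, second and fourth moments
gives `‖u‖₁ ≥ √|J| / √2`. -/

/-! ### Averages of powers, separating steps, extensions and limits of functionals -/

open Filter Topology in
theorem tendsto_average_pow_of_ne_one {z : ℂ} (hz : ‖z‖ = 1) (h1 : z ≠ 1) :
    Tendsto (fun N : ℕ => (N : ℂ)⁻¹ * ∑ k ∈ Finset.range N, z ^ k) atTop (𝓝 0) := by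
  have hb : ∀ N : ℕ, ‖(N : ℂ)⁻¹ * ∑ k ∈ Finset.range N, z ^ k‖ ≤ (N : ℝ)⁻¹ * (2 / ‖z - 1‖) := by
    intro N
    rw [norm_mul, norm_inv, Complex.norm_natCast, geom_sum_eq h1, norm_div]
    gcongr
    calc ‖z ^ N - 1‖ ≤ ‖z ^ N‖ + ‖(1 : ℂ)‖ := norm_sub_le _ _
      _ = 2 := by rw [norm_pow, hz]; norm_num
  refine squeeze_zero_norm hb ?_
  simpa using (tendsto_inv_atTop_nhds_zero_nat (𝕜 := ℝ)).mul_const (2 / ‖z - 1‖)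

open Filter Topology in
theorem tendsto_average_pow_one :
    Tendsto (fun N : ℕ => (N : ℂ)⁻¹ * ∑ k ∈ Finset.range N, (1 : ℂ) ^ k) atTop (𝓝 1) := by
  refine tendsto_const_nhds.congr' ?_
  filter_upwards [eventually_ne_atTop 0] with N hN
  have : (N : ℂ) ≠ 0 := by exact_mod_cast hN
  simp [this]

/-- On a finite set of distinct frequencies, a small step separates the exponentials. -/
theorem exists_step_separating {ω : ℕ+ → ℝ} (hω : Function.Injective ω) (J : Finset ℕ+) :
    ∃ τ : ℝ, ∀ n ∈ J, ∀ m ∈ J, n ≠ m →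
      Complex.exp (((ω n - ω m) * τ : ℝ) * Complex.I) ≠ 1 := by
  -- Since `B` exceeds every `|ω n|` on `J`, all angles `(ω n - ω m) / B` are smaller than `2 < 2π`
  -- in modulus, and the only multiple of `2π` among them is `0`.
  set B : ℝ := ∑ n ∈ J, |ω n| + 1
  have hB : ∀ n ∈ J, |ω n| < B := fun n hn => lt_of_le_of_lt
    (Finset.single_le_sum (f := fun n => |ω n|) (fun _ _ => abs_nonneg _) hn) (lt_add_one _)
  have hB0 : 0 < B := by positivity
  refine ⟨1 / B, fun n hn m hm hnm h => hnm (hω ?_)⟩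
  obtain ⟨k, hk⟩ := Complex.exp_eq_one_iff.1 h
  have hk' : (ω n - ω m) * (1 / B) = k * (2 * Real.pi) := by
    have h2 : (((ω n - ω m) * (1 / B) : ℝ) : ℂ) * Complex.I
        = ((k * (2 * Real.pi) : ℝ) : ℂ) * Complex.I := by
      rw [hk]; push_cast; ring
    exact_mod_cast mul_right_cancel₀ Complex.I_ne_zero h2
  have habs : |(ω n - ω m) * (1 / B)| < 2 := by
    rw [abs_mul, abs_of_pos (by positivity : 0 < 1 / B), mul_one_div, div_lt_iff₀ hB0]
    linarith [abs_sub (ω n) (ω m), hB n hn, hB m hm]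
  have hk0 : k = 0 := by
    by_contra hk0
    have h1 : (1 : ℝ) ≤ |(k : ℝ)| := by exact_mod_cast Int.one_le_abs hk0
    rw [hk', abs_mul, abs_of_pos Real.two_pi_pos] at habs
    nlinarith [Real.pi_gt_three]
  rw [hk0, Int.cast_zero, zero_mul] at hk'
  have : ω n - ω m = 0 := by
    rcases mul_eq_zero.1 hk' with h | h
    · exact h
    · exact absurd h (by positivity)
  linarith

/-- Hahn–Banach along an isometric embedding. -/
theorem LinearIsometry.exists_dual_extension {X Y : Type*} [NormedAddCommGroup X]
    [NormedSpace ℂ X] [NormedAddCommGroup Y] [NormedSpace ℂ Y] (I : X →ₗᵢ[ℂ] Y)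
    (f : StrongDual ℂ X) : ∃ g : StrongDual ℂ Y, (∀ x, g (I x) = f x) ∧ ‖g‖ = ‖f‖ := by
  obtain ⟨g, hg, hn⟩ := exists_extension_norm_eq I.range
    (f.comp (I.equivRange.symm.toContinuousLinearEquiv : I.range →L[ℂ] X))
  refine ⟨g, fun x => ?_, hn.trans ?_⟩
  · have := hg (I.equivRange x)
    simpa using this
  · exact ContinuousLinearMap.opNorm_comp_linearIsometryEquiv f I.equivRange.symm

open Filter Topology in
/-- A bounded sequence of functionals converges pointwise along any ultrafilter. -/
theorem exists_strongDual_tendsto_ultrafilter {Y : Type*} [NormedAddCommGroup Y] [NormedSpace ℂ Y]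
    (U : Ultrafilter ℕ) (ψ : ℕ → StrongDual ℂ Y) (r : ℝ) (hψ : ∀ N, ‖ψ N‖ ≤ r) :
    ∃ c : StrongDual ℂ Y, ∀ y, Tendsto (fun N => ψ N y) U (𝓝 (c y)) := by
  -- Banach–Alaoglu. An ultrafilter replaces a subsequence because `Y` need not be separable.
  have hc := WeakDual.isCompact_closedBall (𝕜 := ℂ) (E := Y) 0 r
  obtain ⟨c, -, hU⟩ := hc.ultrafilter_le_nhds
    (U.map fun N => WeakDual.toStrongDual.symm (ψ N)) (by
      simp only [Ultrafilter.coe_map, le_principal_iff, mem_map]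
      refine univ_mem' fun N => ?_
      simpa using hψ N)
  refine ⟨WeakDual.toStrongDual c, fun y => ?_⟩
  exact ((WeakDual.eval_continuous y).tendsto c).comp (show Tendsto _ _ _ from hU)

/-! ### Monomials and evaluations on the imaginary axis -/

namespace HInf

variable {ω : ℕ+ → ℝ} {J : Finset ℕ+}

/-- The Dirichlet monomial `s ↦ e^{-ω_n s}`. -/
noncomputable def monomial (ω : ℕ+ → ℝ) (J : Finset ℕ+) (n : J) : HInf ω J :=
  ⟨fun s : ℂ => Complex.exp (-(ω n : ℂ) * s), Submodule.subset_span ⟨n, n.2, rfl⟩⟩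

theorem restrict_monomial (n : J) (t : ℝ) :
    restrict ω J (monomial ω J n) t = Complex.exp (((-(ω n * t) : ℝ) : ℂ) * Complex.I) := by
  rw [restrict_apply]
  change Complex.exp _ = _
  congr 1
  push_cast
  ring

/-- The underlying function of a Dirichlet polynomial, as a linear map. -/
def toFunₗ (ω : ℕ+ → ℝ) (J : Finset ℕ+) : HInf ω J →ₗ[ℂ] (ℂ → ℂ) where
  toFun := toFun
  map_add' _ _ := rfl
  map_smul' _ _ := rfl

theorem span_range_monomial : Submodule.span ℂ (Set.range (monomial ω J)) = ⊤ := by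
  have hinj : Function.Injective (toFunₗ ω J) := fun _ _ h => Subtype.ext h
  have hrange : Submodule.map (toFunₗ ω J) ⊤ = dirichletPolynomials ω J :=
    Submodule.ext fun f => ⟨fun ⟨D, _, hD⟩ => hD ▸ D.2, fun hf => ⟨⟨f, hf⟩, trivial, rfl⟩⟩
  refine Submodule.map_injective_of_injective hinj ?_
  rw [hrange, Submodule.map_span, ← Set.range_comp, dirichletPolynomials, Set.image_eq_range]
  rfl

instance : FiniteDimensional ℂ (HInf ω J) :=
  Module.finite_def.2 (span_range_monomial (ω := ω) (J := J) ▸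
    Submodule.fg_span (Set.finite_range _))

theorem norm_le_iff_restrict {D : HInf ω J} {C : ℝ} (hC : 0 ≤ C) :
    ‖D‖ ≤ C ↔ ∀ t : ℝ, ‖restrict ω J D t‖ ≤ C :=
  BoundedContinuousFunction.norm_le (f := restrict ω J D) hC

/-- Restriction to the imaginary axis as an isometric embedding. -/
noncomputable def restrictₗᵢ (ω : ℕ+ → ℝ) (J : Finset ℕ+) : HInf ω J →ₗᵢ[ℂ] (ℝ →ᵇ ℂ) where
  toLinearMap := restrict ω J
  norm_map' _ := rfl

/-- Evaluation at the point `it` of the imaginary axis. -/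
noncomputable def evalImag (ω : ℕ+ → ℝ) (J : Finset ℕ+) (t : ℝ) : StrongDual ℂ (HInf ω J) :=
  (BoundedContinuousFunction.evalCLM ℂ t).comp (restrictₗᵢ ω J).toContinuousLinearMap

theorem evalImag_apply (t : ℝ) (D : HInf ω J) : evalImag ω J t D = restrict ω J D t := rfl

theorem norm_evalImag_le (t : ℝ) : ‖evalImag ω J t‖ ≤ 1 :=
  ContinuousLinearMap.opNorm_le_bound _ zero_le_one fun D => by
    rw [one_mul, evalImag_apply]
    exact (norm_le_iff_restrict (norm_nonneg D)).1 le_rfl t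

end HInf

/-! ### The upper bound: averaged coefficient functionals -/

namespace HInf

variable {ω : ℕ+ → ℝ} {J : Finset ℕ+}

theorem exp_mul_exp_neg_pow (a b τ : ℝ) (k : ℕ) :
    Complex.exp ((a * (k * τ) : ℝ) * Complex.I) * Complex.exp ((-(b * (k * τ)) : ℝ) * Complex.I) =
      Complex.exp (((a - b) * τ : ℝ) * Complex.I) ^ k := by
  rw [← Complex.exp_add, ← Complex.exp_nat_mul]
  congr 1
  push_cast
  ring

open Filter Topology in
theorem tendsto_average_exp (J : Finset ℕ+) {τ : ℝ}
    (hτ : ∀ n ∈ J, ∀ m ∈ J, n ≠ m → Complex.exp (((ω n - ω m) * τ : ℝ) * Complex.I) ≠ 1)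
    (n m : J) :
    Tendsto (fun N : ℕ => (N : ℂ)⁻¹ * ∑ k ∈ Finset.range N,
      Complex.exp (((ω n - ω m) * τ : ℝ) * Complex.I) ^ k) atTop (𝓝 (if n = m then 1 else 0)) := by
  split_ifs with h
  · subst h
    simpa using tendsto_average_pow_one
  · exact tendsto_average_pow_of_ne_one (Complex.norm_exp_ofReal_mul_I _)
      (hτ n n.2 m m.2 fun h' => h (Subtype.ext h'))

open Filter Topology in
/-- The quadratic averages of the exponential sum over `J` tend to the cardinality of `J`. -/
theorem tendsto_average_norm_sq (J : Finset ℕ+) {τ : ℝ}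
    (hτ : ∀ n ∈ J, ∀ m ∈ J, n ≠ m → Complex.exp (((ω n - ω m) * τ : ℝ) * Complex.I) ≠ 1)
    (t : ℝ) :
    Tendsto (fun N : ℕ => (N : ℝ)⁻¹ * ∑ k ∈ Finset.range N,
      ‖∑ n : J, Complex.exp ((ω n * (k * τ) : ℝ) * Complex.I) *
        Complex.exp ((-(ω n * t) : ℝ) * Complex.I)‖ ^ 2) atTop (𝓝 (J.card : ℝ)) := by
  -- The squared modulus expands into a double sum over `n, m`; averaging over `k` kills the
  -- off-diagonal terms, and each diagonal term contributes `1`.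
  have hlim : Tendsto (fun N : ℕ => ∑ n : J, ∑ m : J,
      Complex.exp ((-((ω n - ω m) * t) : ℝ) * Complex.I) * ((N : ℂ)⁻¹ * ∑ k ∈ Finset.range N,
      Complex.exp (((ω n - ω m) * τ : ℝ) * Complex.I) ^ k)) atTop (𝓝 (∑ n : J, ∑ m : J,
      Complex.exp ((-((ω n - ω m) * t) : ℝ) * Complex.I) * (if n = m then 1 else 0))) :=
    tendsto_finsetSum _ fun n _ => tendsto_finsetSum _ fun m _ =>
      (tendsto_average_exp J hτ n m).const_mul _
  have hval : (∑ n : J, ∑ m : J,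
      Complex.exp ((-((ω n - ω m) * t) : ℝ) * Complex.I) * (if n = m then 1 else 0))
      = (J.card : ℂ) := by
    simp
  rw [hval] at hlim
  refine ((Complex.continuous_re.tendsto _).comp hlim).congr fun N => ?_
  rw [Function.comp_apply, ← Complex.ofReal_re ((N : ℝ)⁻¹ * _)]
  congr 1
  have hk : ∀ k : ℕ, ((‖∑ n : J, Complex.exp ((ω n * (k * τ) : ℝ) * Complex.I) *
        Complex.exp ((-(ω n * t) : ℝ) * Complex.I)‖ ^ 2 : ℝ) : ℂ) = ∑ n : J, ∑ m : J,
      Complex.exp ((-((ω n - ω m) * t) : ℝ) * Complex.I) *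
        Complex.exp (((ω n - ω m) * τ : ℝ) * Complex.I) ^ k := by
    intro k
    rw [Complex.ofReal_pow, ← Complex.mul_conj', map_sum, Finset.sum_mul_sum]
    refine Finset.sum_congr rfl fun n _ => Finset.sum_congr rfl fun m _ => ?_
    rw [map_mul, ← Complex.exp_conj, ← Complex.exp_conj, ← Complex.exp_nat_mul]
    simp only [map_mul, Complex.conj_ofReal, Complex.conj_I, ← Complex.exp_add]
    congr 1
    push_cast
    ring
  rw [Complex.ofReal_mul, Complex.ofReal_inv, Complex.ofReal_natCast, Complex.ofReal_sum]
  simp_rw [hk, Finset.mul_sum]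
  rw [Finset.sum_comm (s := Finset.range N)]
  refine Finset.sum_congr rfl fun n _ => ?_
  rw [Finset.sum_comm (s := Finset.range N)]
  refine Finset.sum_congr rfl fun m _ => Finset.sum_congr rfl fun k _ => ?_
  ring

/-- Cauchy–Schwarz for the mean; at `N = 0` both sides vanish because `0⁻¹ = 0`. -/
theorem average_le_sqrt_average_sq (a : ℕ → ℝ) (N : ℕ) :
    (N : ℝ)⁻¹ * ∑ k ∈ Finset.range N, a k ≤
      √((N : ℝ)⁻¹ * ∑ k ∈ Finset.range N, a k ^ 2) := by
  refine Real.le_sqrt_of_sq_le ?_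
  rcases Nat.eq_zero_or_pos N with rfl | hN
  · simp
  have hN' : (0 : ℝ) < N := by exact_mod_cast hN
  have h := sq_sum_le_card_mul_sum_sq (s := Finset.range N) (f := a)
  rw [Finset.card_range] at h
  calc ((N : ℝ)⁻¹ * ∑ k ∈ Finset.range N, a k) ^ 2
      = (N : ℝ)⁻¹ ^ 2 * (∑ k ∈ Finset.range N, a k) ^ 2 := mul_pow _ _ _
    _ ≤ (N : ℝ)⁻¹ ^ 2 * (N * ∑ k ∈ Finset.range N, a k ^ 2) := by gcongr
    _ = (N : ℝ)⁻¹ * ∑ k ∈ Finset.range N, a k ^ 2 := by field_simp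

open Filter Topology in
/-- Every isometric embedding of `H_∞^J(ω)` has a left inverse of norm at most `√|J|`. -/
theorem exists_left_inverse (hω : Function.Injective ω) {Y : Type*} [NormedAddCommGroup Y]
    [NormedSpace ℂ Y] (I : HInf ω J →ₗᵢ[ℂ] Y) :
    ∃ Q : Y →L[ℂ] HInf ω J, (∀ D, Q (I D) = D) ∧ ‖Q‖ ≤ √(J.card : ℝ) := by
  obtain ⟨τ, hτ⟩ := exists_step_separating hω J
  choose φ hφ hφn using fun k : ℕ => I.exists_dual_extension (evalImag ω J (k * τ))
  have hφ1 : ∀ k, ‖φ k‖ ≤ 1 := fun k => (hφn k).trans_le (norm_evalImag_le _)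
  -- Discrete Bohr coefficients, with the extended evaluations `φ k` in place of the values
  -- `D(ikτ)`.
  let ψ : J → ℕ → StrongDual ℂ Y := fun n N => (N : ℂ)⁻¹ • ∑ k ∈ Finset.range N,
    Complex.exp ((ω n * (k * τ) : ℝ) * Complex.I) • φ k
  have hψ : ∀ n N, ‖ψ n N‖ ≤ 1 := by
    intro n N
    rw [norm_smul, norm_inv, Complex.norm_natCast]
    have : ‖∑ k ∈ Finset.range N, Complex.exp ((ω n * (k * τ) : ℝ) * Complex.I) • φ k‖ ≤ N := by
      refine (norm_sum_le_of_le (Finset.range N) (f := fun k : ℕ =>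
        Complex.exp ((ω n * (k * τ) : ℝ) * Complex.I) • φ k)
        (n := fun _ => (1 : ℝ)) fun k _ => ?_).trans (by simp)
      rw [norm_smul, Complex.norm_exp_ofReal_mul_I, one_mul]
      exact hφ1 k
    exact (mul_le_mul_of_nonneg_left this (by positivity)).trans inv_mul_le_one
  choose c hc using fun n => exists_strongDual_tendsto_ultrafilter (hyperfilter ℕ) (ψ n) 1 (hψ n)
  have hcI : ∀ n m, c n (I (monomial ω J m)) = if n = m then 1 else 0 := by
    intro n m
    -- On the range of `I` the averages genuinely converge, so the ultrafilter limit must be the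
    -- true coefficient.
    refine tendsto_nhds_unique (hc n _)
      (((tendsto_average_exp J hτ n m).mono_left Nat.hyperfilter_le_atTop).congr fun N => ?_)
    simp only [ψ, smul_apply, sum_apply, smul_eq_mul, hφ,
      evalImag_apply, restrict_monomial, exp_mul_exp_neg_pow]
  let Q : Y →L[ℂ] HInf ω J := ∑ n : J, (c n).smulRight (monomial ω J n)
  have hQ : ∀ y, Q y = ∑ n : J, c n y • monomial ω J n := fun y => by
    simp [Q]
  refine ⟨Q, fun D => ?_, ContinuousLinearMap.opNorm_le_bound _ (Real.sqrt_nonneg _) fun y => ?_⟩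
  · have hD : D ∈ Submodule.span ℂ (Set.range (monomial ω J)) := by
      rw [span_range_monomial]; trivial
    induction hD using Submodule.span_induction with
    | mem D hD =>
      obtain ⟨m, rfl⟩ := hD
      simp [hQ, hcI]
    | zero => simp
    | add D E _ _ hD hE => rw [map_add, map_add, hD, hE]
    | smul a D _ hD => rw [map_smul, map_smul, hD]
  · refine (norm_le_iff_restrict (by positivity)).2 fun t => ?_
    have hlim : Tendsto (fun N => ∑ n : J, ψ n N y *
        Complex.exp ((-(ω n * t) : ℝ) * Complex.I)) (hyperfilter ℕ : Filter ℕ)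
        (𝓝 (restrict ω J (Q y) t)) := by
      have : restrict ω J (Q y) t = ∑ n : J, c n y *
          Complex.exp ((-(ω n * t) : ℝ) * Complex.I) := by
        simp [hQ, map_sum, BoundedContinuousFunction.sum_apply, restrict_monomial]
      rw [this]
      exact tendsto_finsetSum _ fun n _ => (hc n y).mul_const _
    refine le_of_tendsto_of_tendsto hlim.norm
      ((((tendsto_average_norm_sq J hτ t).mono_left Nat.hyperfilter_le_atTop).sqrt).mul_const ‖y‖)
      (Eventually.of_forall fun N => ?_)
    -- Exchanging the sums exposes the kernel before any norm is taken. Bounding the functionals `c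
    -- n` one at a time would only give `|J|` instead of `√|J|`.
    have hsum : ∑ n : J, ψ n N y * Complex.exp ((-(ω n * t) : ℝ) * Complex.I) =
        (N : ℂ)⁻¹ * ∑ k ∈ Finset.range N, φ k y *
          ∑ n : J, Complex.exp ((ω n * (k * τ) : ℝ) * Complex.I) *
            Complex.exp ((-(ω n * t) : ℝ) * Complex.I) := by
      simp only [ψ, smul_apply, sum_apply, smul_eq_mul,
        Finset.mul_sum, Finset.sum_mul]
      rw [Finset.sum_comm]
      refine Finset.sum_congr rfl fun k _ => Finset.sum_congr rfl fun n _ => ?_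
      ring
    simp only [hsum]
    rw [norm_mul, norm_inv, Complex.norm_natCast]
    refine le_trans ?_ (mul_le_mul_of_nonneg_right
      (average_le_sqrt_average_sq _ N) (norm_nonneg y))
    rw [mul_assoc, Finset.sum_mul]
    gcongr
    refine norm_sum_le_of_le _ fun k _ => ?_
    rw [norm_mul, mul_comm]
    gcongr
    simpa using (φ k).le_of_opNorm_le (hφ1 k) y

/-- The projection constant of `H_∞^J(ω)` is at most `√|J|`. -/
theorem projectionConstant_le (hω : Function.Injective ω) (J : Finset ℕ+) :
    projectionConstant (HInf ω J) ≤ ENNReal.ofReal √(J.card : ℝ) := by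
  refine iSup_le fun Y => iSup_le fun _ => iSup_le fun _ => iSup_le fun _ => iSup_le fun I =>
    iSup_le fun _ => ?_
  obtain ⟨Q, hQI, hQ⟩ := exists_left_inverse hω I
  let P : Y →L[ℂ] LinearMap.range I.toLinearMap :=
    (I.toContinuousLinearMap.comp Q).codRestrict _ fun y => ⟨Q y, rfl⟩
  refine (iInf₂_le P ?_).trans ?_
  · rintro ⟨_, D, rfl⟩
    exact Subtype.ext (congrArg I (hQI D))
  · rw [← ofReal_norm]
    refine ENNReal.ofReal_le_ofReal (ContinuousLinearMap.opNorm_le_bound _ (Real.sqrt_nonneg _)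
      fun y => ?_)
    calc ‖P y‖ = ‖Q y‖ := I.norm_map (Q y)
      _ ≤ _ := Q.le_of_opNorm_le hQ y

end HInf

/-! ### Characters, trigonometric polynomials and Haar measure -/

section Characters

variable {G : Type*} [CommGroup G] [TopologicalSpace G]

theorem characterFun_mul (γ δ : PontryaginDual G) :
    characterFun (γ * δ) = characterFun γ * characterFun δ := rfl

theorem characterFun_one : characterFun (1 : PontryaginDual G) = 1 := rfl

theorem characterFun_map_mul (γ : PontryaginDual G) (a b : G) :
    characterFun γ (a * b) = characterFun γ a * characterFun γ b := by
  change ((γ (a * b) : Circle) : ℂ) = (γ a : ℂ) * (γ b : ℂ)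
  rw [map_mul, Circle.coe_mul]

theorem characterFun_inv (γ : PontryaginDual G) : characterFun γ⁻¹ = star (characterFun γ) :=
  ContinuousMap.ext fun a => Circle.coe_inv_eq_conj (γ a)

theorem characterFun_mul_map_inv (γ : PontryaginDual G) (a : G) :
    characterFun γ a * characterFun γ a⁻¹ = 1 := by
  rw [← characterFun_map_mul, mul_inv_cancel]
  change ((γ 1 : Circle) : ℂ) = 1
  rw [map_one, Circle.coe_one]

theorem characterFun_map_inv (γ : PontryaginDual G) (a : G) :
    characterFun γ a⁻¹ = characterFun γ⁻¹ a := by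
  change ((γ a⁻¹ : Circle) : ℂ) = (((γ a)⁻¹ : Circle) : ℂ)
  rw [map_inv]

theorem characterFun_mem_trigPolynomials {E : Set (PontryaginDual G)} {γ : PontryaginDual G}
    (hγ : γ ∈ E) : characterFun γ ∈ trigPolynomials E :=
  Submodule.subset_span ⟨γ, hγ, rfl⟩

theorem trigPolynomials_mono {E F : Set (PontryaginDual G)} (h : E ⊆ F) :
    trigPolynomials E ≤ trigPolynomials F :=
  Submodule.span_mono (Set.image_mono h)

theorem trigPolynomials_induction {E : Set (PontryaginDual G)} {p : C(G, ℂ) → Prop}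
    (char : ∀ γ ∈ E, p (characterFun γ)) (zero : p 0) (add : ∀ f g, p f → p g → p (f + g))
    (smul : ∀ (c : ℂ) f, p f → p (c • f)) {f : C(G, ℂ)} (hf : f ∈ trigPolynomials E) : p f := by
  induction hf using Submodule.span_induction with
  | mem f hf => obtain ⟨γ, hγ, rfl⟩ := hf; exact char γ hγ
  | zero => exact zero
  | add f g _ _ hf hg => exact add f g hf hg
  | smul c f _ hf => exact smul c f hf

theorem mul_mem_trigPolynomials_univ {f g : C(G, ℂ)}
    (hf : f ∈ trigPolynomials (Set.univ : Set (PontryaginDual G)))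
    (hg : g ∈ trigPolynomials (Set.univ : Set (PontryaginDual G))) :
    f * g ∈ trigPolynomials (Set.univ : Set (PontryaginDual G)) := by
  refine trigPolynomials_induction (p := fun f => f * g ∈ trigPolynomials Set.univ)
    (fun γ _ => ?_) (by simp) (fun _ _ h h' => by rw [add_mul]; exact add_mem h h')
    (fun c _ h => by rw [smul_mul_assoc]; exact Submodule.smul_mem _ c h) hf
  refine trigPolynomials_induction (p := fun g => characterFun γ * g ∈ trigPolynomials Set.univ)
    (fun δ _ => ?_) (by simp) (fun _ _ h h' => by rw [mul_add]; exact add_mem h h')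
    (fun c _ h => by rw [mul_smul_comm]; exact Submodule.smul_mem _ c h) hg
  rw [← characterFun_mul]
  exact characterFun_mem_trigPolynomials (Set.mem_univ _)

theorem star_mem_trigPolynomials_univ {f : C(G, ℂ)}
    (hf : f ∈ trigPolynomials (Set.univ : Set (PontryaginDual G))) :
    star f ∈ trigPolynomials (Set.univ : Set (PontryaginDual G)) := by
  refine trigPolynomials_induction (p := fun f => star f ∈ trigPolynomials Set.univ)
    (fun γ _ => ?_) (by simp) (fun _ _ h h' => by rw [star_add]; exact add_mem h h')
    (fun c _ h => by rw [star_smul]; exact Submodule.smul_mem _ _ h) hf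
  rw [← characterFun_inv]
  exact characterFun_mem_trigPolynomials (Set.mem_univ _)

/-- Products and conjugates of characters are characters, so polynomial expressions stay inside the
trigonometric polynomials. This makes the test function in `integral_norm_le_of_duality` admissible.
-/
theorem aeval_mem_trigPolynomials_univ {f : C(G, ℂ)}
    (hf : f ∈ trigPolynomials (Set.univ : Set (PontryaginDual G))) (q : Polynomial ℂ) :
    Polynomial.aeval f q ∈ trigPolynomials (Set.univ : Set (PontryaginDual G)) := by
  rw [Polynomial.aeval_eq_sum_range]
  refine Submodule.sum_mem _ fun i hi => Submodule.smul_mem _ _ ?_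
  clear hi
  induction i with
  | zero =>
    rw [pow_zero, ← characterFun_one]
    exact characterFun_mem_trigPolynomials (Set.mem_univ _)
  | succ i ih => rw [pow_succ]; exact mul_mem_trigPolynomials_univ ih hf

/-- Translation of a continuous function. -/
noncomputable def ContinuousMap.translate [IsTopologicalGroup G] (a : G) (g : C(G, ℂ)) : C(G, ℂ) :=
  g.comp ⟨fun b => a * b, continuous_const_mul a⟩

theorem norm_translate_le [IsTopologicalGroup G] [CompactSpace G] (a : G)
    (g : C(G, ℂ)) : ‖ContinuousMap.translate a g‖ ≤ ‖g‖ :=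
  (ContinuousMap.norm_le _ (norm_nonneg g)).2 fun b => g.norm_coe_le_norm (a * b)

theorem translate_characterFun [IsTopologicalGroup G] (a : G) (γ : PontryaginDual G) :
    ContinuousMap.translate a (characterFun γ) = characterFun γ a • characterFun γ :=
  ContinuousMap.ext fun b => characterFun_map_mul γ a b

/-- The sum of a finite family of characters. -/
noncomputable def characterSum {ι : Type*} (s : Finset ι) (h : ι → PontryaginDual G) : C(G, ℂ) :=
  ∑ i ∈ s, characterFun (h i)

theorem characterSum_apply {ι : Type*} (s : Finset ι) (h : ι → PontryaginDual G) (a : G) :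
    characterSum s h a = ∑ i ∈ s, characterFun (h i) a := by
  simp [characterSum]

theorem characterSum_mem {ι : Type*} (s : Finset ι) (h : ι → PontryaginDual G) :
    characterSum s h ∈ trigPolynomials (h '' s) :=
  Submodule.sum_mem _ fun i hi => characterFun_mem_trigPolynomials ⟨i, hi, rfl⟩

variable [IsTopologicalGroup G] [CompactSpace G] [MeasurableSpace G] [BorelSpace G]

open MeasureTheory

instance : (normalizedHaar G).IsHaarMeasure := Measure.isHaarMeasure_haarMeasure _

instance : IsProbabilityMeasure (normalizedHaar G) :=
  ⟨Measure.haarMeasure_self (K₀ := (⊤ : TopologicalSpace.PositiveCompacts G))⟩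

theorem integrable_normalizedHaar {F : Type*} [NormedAddCommGroup F] {f : G → F}
    (hf : Continuous f) : Integrable f (normalizedHaar G) :=
  hf.integrable_of_hasCompactSupport (HasCompactSupport.of_compactSpace f)

-- Translating by `b` multiplies the integral by `γ b`; invariance forces it to vanish once some `γ
-- b ≠ 1`.
open Classical in
theorem integral_characterFun (γ : PontryaginDual G) :
    ∫ a, characterFun γ a ∂(normalizedHaar G) = if γ = 1 then 1 else 0 := by
  split_ifs with h
  · subst h
    simp [characterFun_one]
  · obtain ⟨b, hb⟩ : ∃ b, characterFun γ b ≠ 1 := by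
      by_contra! hall
      exact h (PontryaginDual.ext fun a => Circle.ext (hall a))
    have hinv := integral_mul_left_eq_self (μ := normalizedHaar G) (fun a => characterFun γ a) b
    simp only [characterFun_map_mul, integral_const_mul] at hinv
    have : (characterFun γ b - 1) * ∫ a, characterFun γ a ∂(normalizedHaar G) = 0 := by
      rw [sub_mul, hinv, one_mul, sub_self]
    exact (mul_eq_zero.1 this).resolve_left (sub_ne_zero.2 hb)

open Classical in
/-- Orthonormality of characters. -/
theorem integral_characterFun_mul_star (γ δ : PontryaginDual G) :
    ∫ a, characterFun γ a * star (characterFun δ a) ∂(normalizedHaar G) =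
      if γ = δ then 1 else 0 := by
  have h : ∀ a, characterFun γ a * star (characterFun δ a) = characterFun (γ * δ⁻¹) a := by
    intro a
    rw [characterFun_mul, characterFun_inv]
    rfl
  simp_rw [h, integral_characterFun, mul_inv_eq_one]

end Characters

/-! ### Duality and averaging of projections over translations -/

section TrigonometricSums

variable {G : Type*} [CommGroup G] [TopologicalSpace G] [IsTopologicalGroup G] [CompactSpace G]
  [MeasurableSpace G] [BorelSpace G]

open MeasureTheory

/-- For complex `z` with `|z| = r`, the factor `1 / √(r² + ε²)` turns `z` into a substitute for `z /
|z|` that is continuous at zero: its modulus is at most `1`, and pairing it with `z` loses at most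
`ε`. -/
theorem regularized_sign_bounds {r ε : ℝ} (hr : 0 ≤ r) (hε : 0 < ε) :
    r * (1 / √(r ^ 2 + ε ^ 2)) ≤ 1 ∧ r - ε ≤ r ^ 2 * (1 / √(r ^ 2 + ε ^ 2)) := by
  have hpos : 0 < √(r ^ 2 + ε ^ 2) := Real.sqrt_pos.2 (by positivity)
  have hle : √(r ^ 2 + ε ^ 2) ≤ r + ε :=
    Real.sqrt_le_iff.2 ⟨by positivity, by nlinarith⟩
  refine ⟨?_, ?_⟩
  · rw [mul_one_div, div_le_one hpos]
    exact Real.le_sqrt_of_sq_le (by nlinarith)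
  · rw [mul_one_div, le_div_iff₀ hpos]
    rcases le_total r ε with h | h
    · nlinarith
    · nlinarith

/-- If integration against `conj u` has norm at most `K` on trigonometric polynomials, then
`‖u‖₁ ≤ K`. -/
theorem integral_norm_le_of_duality {u : C(G, ℂ)} (hu : u ∈ trigPolynomials Set.univ) {K : ℝ}
    (hK : 0 ≤ K) (h : ∀ g ∈ trigPolynomials (Set.univ : Set (PontryaginDual G)),
      ‖∫ a, g a * star (u a) ∂(normalizedHaar G)‖ ≤ K * ‖g‖) :
    ∫ a, ‖u a‖ ∂(normalizedHaar G) ≤ K := by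
  refine le_of_forall_pos_le_add fun η hη => ?_
  set M := ‖u‖
  have hM : 0 ≤ M := norm_nonneg u
  -- The errors below are `δ + M²δ` in the lower estimate and `KMδ` in the upper one; this `δ` makes
  -- them add up to `η`.
  set δ := η / (1 + M ^ 2 + K * M)
  have hden : 0 < 1 + M ^ 2 + K * M := by positivity
  have hδ : 0 < δ := by positivity
  have hδη : δ * (1 + M ^ 2 + K * M) = η := div_mul_cancel₀ _ hden.ne'
  -- Weierstrass on `[0, M²]`, which contains all values of `|u|²`. A polynomial in `|u|² = u · star
  -- u` is again a trigonometric polynomial, so `g = u · q(|u|²)` is an admissible approximate sign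
  -- of `u`.
  obtain ⟨q, hq⟩ := exists_polynomial_near_of_continuousOn 0 (M ^ 2)
    (fun s => 1 / √(s + δ ^ 2)) (by
      refine ContinuousOn.div continuousOn_const (by fun_prop) fun s hs => ?_
      exact (Real.sqrt_pos.2 (by have := hs.1; positivity)).ne') δ hδ
  have hua : ∀ a, ‖u a‖ ≤ M := fun a => u.norm_coe_le_norm a
  have hqa : ∀ a, |q.eval (‖u a‖ ^ 2) - 1 / √(‖u a‖ ^ 2 + δ ^ 2)| < δ := fun a =>
    hq _ ⟨by positivity, by have := hua a; gcongr⟩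
  set g : C(G, ℂ) := u * Polynomial.aeval (u * star u) (q.map Complex.ofRealHom)
  have hg : g ∈ trigPolynomials (Set.univ : Set (PontryaginDual G)) :=
    mul_mem_trigPolynomials_univ hu (aeval_mem_trigPolynomials_univ
      (mul_mem_trigPolynomials_univ hu (star_mem_trigPolynomials_univ hu)) _)
  have hga : ∀ a, g a = u a * (q.eval (‖u a‖ ^ 2) : ℝ) := by
    intro a
    have h1 : (Polynomial.aeval (u * star u) (q.map Complex.ofRealHom)) a =
        Polynomial.aeval ((u * star u) a) (q.map Complex.ofRealHom) :=
      (Polynomial.aeval_algHom_apply (ContinuousMap.evalAlgHom ℂ ℂ a) (u * star u) _).symm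
    have h2 : (u * star u) a = Complex.ofRealHom (‖u a‖ ^ 2) := by
      rw [ContinuousMap.mul_apply, ContinuousMap.star_apply]
      simpa using Complex.mul_conj' (u a)
    rw [ContinuousMap.mul_apply, h1, h2, Polynomial.coe_aeval_eq_eval, Polynomial.eval_map_apply]
    rfl
  have hgn : ‖g‖ ≤ 1 + M * δ := by
    refine (ContinuousMap.norm_le _ (by positivity)).2 fun a => ?_
    rw [hga, norm_mul, Complex.norm_real, Real.norm_eq_abs]
    have hb := (regularized_sign_bounds (norm_nonneg (u a)) hδ).1
    have habs : |q.eval (‖u a‖ ^ 2)| ≤ 1 / √(‖u a‖ ^ 2 + δ ^ 2) + δ := by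
      have h1 := abs_lt.1 (hqa a)
      have h2 : 0 ≤ 1 / √(‖u a‖ ^ 2 + δ ^ 2) := by positivity
      exact abs_le.2 ⟨by linarith, by linarith⟩
    calc ‖u a‖ * |q.eval (‖u a‖ ^ 2)| ≤ ‖u a‖ * (1 / √(‖u a‖ ^ 2 + δ ^ 2) + δ) := by gcongr
      _ = ‖u a‖ * (1 / √(‖u a‖ ^ 2 + δ ^ 2)) + ‖u a‖ * δ := mul_add _ _ _
      _ ≤ 1 + M * δ := add_le_add hb (mul_le_mul_of_nonneg_right (hua a) hδ.le)
  have hint : ∫ a, g a * star (u a) ∂(normalizedHaar G) =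
      ((∫ a, ‖u a‖ ^ 2 * q.eval (‖u a‖ ^ 2) ∂(normalizedHaar G) : ℝ) : ℂ) := by
    rw [← integral_complex_ofReal]
    refine integral_congr_ae (Filter.Eventually.of_forall fun a => ?_)
    have := Complex.mul_conj' (u a)
    simp only [hga, Complex.ofReal_mul, Complex.ofReal_pow, ← this]
    rw [← starRingEnd_apply]
    ring
  have hlow : ∫ a, ‖u a‖ ∂(normalizedHaar G) - (δ + M ^ 2 * δ) ≤
      ∫ a, ‖u a‖ ^ 2 * q.eval (‖u a‖ ^ 2) ∂(normalizedHaar G) := by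
    have hc : ∫ a, (‖u a‖ - (δ + M ^ 2 * δ)) ∂(normalizedHaar G) =
        ∫ a, ‖u a‖ ∂(normalizedHaar G) - (δ + M ^ 2 * δ) := by
      rw [integral_sub (integrable_normalizedHaar (by fun_prop)) (integrable_const _)]
      simp
    rw [← hc]
    refine integral_mono (integrable_normalizedHaar (by fun_prop))
      (integrable_normalizedHaar ?_) fun a => ?_
    · have := q.continuous
      fun_prop
    · have hb := (regularized_sign_bounds (norm_nonneg (u a)) hδ).2
      have h1 := (abs_lt.1 (hqa a)).1
      have h2 : ‖u a‖ ^ 2 ≤ M ^ 2 := by have := hua a; gcongr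
      have h3 : ‖u a‖ ^ 2 * (1 / √(‖u a‖ ^ 2 + δ ^ 2) - δ) ≤
          ‖u a‖ ^ 2 * q.eval (‖u a‖ ^ 2) := by gcongr; linarith
      have h4 := mul_le_mul_of_nonneg_right h2 hδ.le
      simp only
      linarith
  have hup : ∫ a, ‖u a‖ ^ 2 * q.eval (‖u a‖ ^ 2) ∂(normalizedHaar G) ≤ K * (1 + M * δ) := by
    have h1 := h g hg
    rw [hint, Complex.norm_real] at h1
    exact (le_abs_self _).trans (h1.trans (by gcongr))
  nlinarith

variable {ι : Type*} {s : Finset ι} {h : ι → PontryaginDual G}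

open Classical in
theorem integral_mul_star_characterSum (hh : Set.InjOn h s) (γ : PontryaginDual G) :
    ∫ a, characterFun γ a * star (characterSum s h a) ∂(normalizedHaar G) =
      if γ ∈ h '' s then 1 else 0 := by
  simp_rw [characterSum_apply, star_sum, Finset.mul_sum]
  rw [integral_finsetSum _ fun i _ => integrable_normalizedHaar (by fun_prop)]
  simp_rw [integral_characterFun_mul_star]
  split_ifs with hγ
  · obtain ⟨i, hi, rfl⟩ := hγ
    rw [Finset.sum_eq_single_of_mem i hi fun j hj hji => if_neg fun e => hji (hh hj hi e.symm)]
    exact if_pos rfl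
  · exact Finset.sum_eq_zero fun i hi => if_neg fun e => hγ ⟨i, hi, e.symm⟩

/-- Averaging a projection onto the span of finitely many characters over all translations gives
the convolution with the sum of these characters. -/
theorem integral_average_projection (hh : Set.InjOn h s) (R : C(G, ℂ) →L[ℂ] C(G, ℂ))
    (hR : ∀ g, R g ∈ trigPolynomials (h '' s)) (hRid : ∀ g ∈ trigPolynomials (h '' s), R g = g)
    {g : C(G, ℂ)} (hg : g ∈ trigPolynomials (Set.univ : Set (PontryaginDual G))) :
    Integrable (fun a => R (g.translate a) a⁻¹) (normalizedHaar G) ∧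
      ∫ a, R (g.translate a) a⁻¹ ∂(normalizedHaar G) =
        ∫ a, g a * star (characterSum s h a) ∂(normalizedHaar G) := by
  -- By linearity it suffices to take `g` a character `γ`, for which the integrand is `γ(a)
  -- (Rγ)(a⁻¹)`. If `γ` belongs to the family, `Rγ = γ` and the integrand is `1`; otherwise `Rγ` is
  -- a combination of characters orthogonal to `γ`. Integrability is carried along because
  -- additivity of the integral needs it.
  refine trigPolynomials_induction (p := fun g =>
    Integrable (fun a => R (g.translate a) a⁻¹) (normalizedHaar G) ∧
      ∫ a, R (g.translate a) a⁻¹ ∂(normalizedHaar G) =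
        ∫ a, g a * star (characterSum s h a) ∂(normalizedHaar G)) (fun γ _ => ?_) ?_
    (fun f g hf hg => ?_) (fun c f hf => ?_) hg
  · have hval : ∀ a, R ((characterFun γ).translate a) a⁻¹ =
        characterFun γ a * R (characterFun γ) a⁻¹ := by
      intro a
      rw [translate_characterFun, map_smul]
      rfl
    simp_rw [hval]
    refine ⟨integrable_normalizedHaar (by fun_prop), ?_⟩
    rw [integral_mul_star_characterSum hh]
    split_ifs with hγ
    · rw [hRid _ (characterFun_mem_trigPolynomials hγ)]
      simp [characterFun_mul_map_inv]
    · refine trigPolynomials_induction (p := fun D =>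
        ∫ a, characterFun γ a * D a⁻¹ ∂(normalizedHaar G) = 0) (fun δ hδ => ?_) (by simp)
        (fun f g hf hg => ?_) (fun c f hf => ?_) (hR (characterFun γ))
      · have h1 : ∀ a, characterFun γ a * characterFun δ a⁻¹ =
            characterFun γ a * star (characterFun δ a) := fun a => by
          rw [characterFun_map_inv, characterFun_inv]; rfl
        simp_rw [h1]
        rw [integral_characterFun_mul_star, if_neg]
        rintro rfl
        exact hγ hδ
      · simp only [ContinuousMap.add_apply, mul_add]
        rw [integral_add (integrable_normalizedHaar (by fun_prop))
          (integrable_normalizedHaar (by fun_prop)), hf, hg, add_zero]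
      · simp only [ContinuousMap.smul_apply, smul_eq_mul, mul_left_comm _ c]
        rw [integral_const_mul, hf, mul_zero]
  · have hz : ∀ a : G, (0 : C(G, ℂ)).translate a = 0 := fun a => rfl
    simp [hz]
  · have hadd : ∀ a : G, (f + g).translate a = f.translate a + g.translate a := fun a => rfl
    simp only [hadd, map_add, ContinuousMap.add_apply, add_mul]
    refine ⟨hf.1.add hg.1, ?_⟩
    rw [integral_add hf.1 hg.1, integral_add (integrable_normalizedHaar (by fun_prop))
      (integrable_normalizedHaar (by fun_prop)), hf.2, hg.2]
  · have hsmul : ∀ a : G, (c • f).translate a = c • f.translate a := fun a => rfl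
    simp only [hsmul, map_smul, ContinuousMap.smul_apply, smul_eq_mul, mul_assoc]
    exact ⟨hf.1.const_mul c, by rw [integral_const_mul, integral_const_mul, hf.2]⟩

/-- A projection of `C(G)` onto the span of finitely many characters has norm at least the
`L₁`-norm of the sum of these characters. -/
theorem integral_norm_characterSum_le (hh : Set.InjOn h s) (R : C(G, ℂ) →L[ℂ] C(G, ℂ))
    (hR : ∀ g, R g ∈ trigPolynomials (h '' s))
    (hRid : ∀ g ∈ trigPolynomials (h '' s), R g = g) :
    ∫ a, ‖characterSum s h a‖ ∂(normalizedHaar G) ≤ ‖R‖ := by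
  refine integral_norm_le_of_duality (trigPolynomials_mono (Set.subset_univ _)
    (characterSum_mem s h)) (norm_nonneg R) fun g hg => ?_
  -- Translations are contractions and the measure is a probability, so the averaged functional has
  -- norm at most `‖R‖`.
  rw [← (integral_average_projection hh R hR hRid hg).2]
  refine (norm_integral_le_of_norm_le_const (C := ‖R‖ * ‖g‖)
    (Filter.Eventually.of_forall fun a => ?_)).trans (by simp)
  exact ((R (g.translate a)).norm_coe_le_norm _).trans
    ((R.le_opNorm _).trans (mul_le_mul_of_nonneg_left (norm_translate_le a g) (norm_nonneg R)))

end TrigonometricSums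

/-! ### Moments of character sums -/

section Moments

variable {G : Type*} [CommGroup G] [TopologicalSpace G] [IsTopologicalGroup G] [CompactSpace G]
  [MeasurableSpace G] [BorelSpace G]

open MeasureTheory

variable {ι : Type*} {s : Finset ι} {h : ι → PontryaginDual G}

theorem integral_norm_sq_characterSum (hh : Set.InjOn h s) :
    ∫ a, ‖characterSum s h a‖ ^ 2 ∂(normalizedHaar G) = s.card := by
  have h1 : ((∫ a, ‖characterSum s h a‖ ^ 2 ∂(normalizedHaar G) : ℝ) : ℂ) =
      ∫ a, characterSum s h a * star (characterSum s h a) ∂(normalizedHaar G) := by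
    rw [← integral_complex_ofReal]
    refine integral_congr_ae (Filter.Eventually.of_forall fun a => ?_)
    simpa using (Complex.mul_conj' (characterSum s h a)).symm
  have h2 : ∫ a, characterSum s h a * star (characterSum s h a) ∂(normalizedHaar G) = s.card := by
    have h3 : ∀ a, characterSum s h a * star (characterSum s h a) =
        ∑ i ∈ s, characterFun (h i) a * star (characterSum s h a) := fun a => by
      rw [← Finset.sum_mul, ← characterSum_apply]
    simp_rw [h3]
    rw [integral_finsetSum _ fun i _ => integrable_normalizedHaar (by fun_prop)]
    simp_rw [integral_mul_star_characterSum hh]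
    rw [Finset.sum_congr rfl fun i hi => if_pos (Set.mem_image_of_mem h hi)]
    simp
  exact_mod_cast h1.trans h2

/-- The fourth moment of a sum of characters whose pairwise products determine the pairs. -/
theorem integral_norm_pow_four_characterSum_le
    (hB : ∀ i ∈ s, ∀ j ∈ s, ∀ k ∈ s, ∀ l ∈ s, h i * h j = h k * h l →
      (k = i ∧ l = j) ∨ (k = j ∧ l = i)) :
    ∫ a, ‖characterSum s h a‖ ^ 4 ∂(normalizedHaar G) ≤ 2 * (s.card : ℝ) ^ 2 := by
  classical
  -- Writing `|u|⁴ = |u²|²` and using orthonormality, the fourth moment counts the quadruples with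
  -- `h i * h j = h k * h l`.
  have h1 : ((∫ a, ‖characterSum s h a‖ ^ 4 ∂(normalizedHaar G) : ℝ) : ℂ) =
      ∑ p ∈ s ×ˢ s, ∑ r ∈ s ×ˢ s, if h p.1 * h p.2 = h r.1 * h r.2 then 1 else 0 := by
    have h2 : ∀ a, ((‖characterSum s h a‖ ^ 4 : ℝ) : ℂ) = ∑ p ∈ s ×ˢ s, ∑ r ∈ s ×ˢ s,
        characterFun (h p.1 * h p.2) a * star (characterFun (h r.1 * h r.2) a) := by
      intro a
      have h3 : characterSum s h a ^ 2 = ∑ p ∈ s ×ˢ s, characterFun (h p.1 * h p.2) a := by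
        rw [sq, characterSum_apply, Finset.sum_mul_sum, ← Finset.sum_product']
        rfl
      rw [← Finset.sum_mul_sum, ← star_sum, ← h3, Complex.star_def, Complex.mul_conj', norm_pow]
      push_cast
      ring
    rw [← integral_complex_ofReal]
    simp_rw [h2]
    rw [integral_finsetSum _ fun i _ => integrable_normalizedHaar (by fun_prop)]
    refine Finset.sum_congr rfl fun p _ => ?_
    rw [integral_finsetSum _ fun i _ => integrable_normalizedHaar (by fun_prop)]
    refine Finset.sum_congr rfl fun r _ => ?_
    rw [integral_characterFun_mul_star]
  have h4 : ∫ a, ‖characterSum s h a‖ ^ 4 ∂(normalizedHaar G) =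
      ∑ p ∈ s ×ˢ s, ∑ r ∈ s ×ˢ s, if h p.1 * h p.2 = h r.1 * h r.2 then (1 : ℝ) else 0 := by
    apply Complex.ofReal_injective
    rw [h1]
    simp only [Complex.ofReal_sum, apply_ite Complex.ofReal, Complex.ofReal_one,
      Complex.ofReal_zero]
  rw [h4]
  have h5 : ∀ p ∈ s ×ˢ s,
      (∑ r ∈ s ×ˢ s, if h p.1 * h p.2 = h r.1 * h r.2 then (1 : ℝ) else 0) ≤ 2 := by
    intro p hp
    rw [Finset.sum_boole]
    -- A pair shares its product only with itself and its swap.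
    have hsub : {r ∈ s ×ˢ s | h p.1 * h p.2 = h r.1 * h r.2} ⊆ {p, p.swap} := by
      intro r hr
      simp only [Finset.mem_filter, Finset.mem_product] at hr hp
      have := hB _ hp.1 _ hp.2 _ hr.1.1 _ hr.1.2 hr.2
      simpa [Prod.ext_iff] using this
    exact_mod_cast (Finset.card_le_card hsub).trans Finset.card_le_two
  refine (Finset.sum_le_sum h5).trans (le_of_eq ?_)
  rw [Finset.sum_const, Finset.card_product, nsmul_eq_mul]
  push_cast
  ring

/-- A lower bound for the first moment in terms of the second and the fourth one. -/
theorem sqrt_half_le_integral_norm {f : C(G, ℂ)} {c : ℝ} (hc : 0 < c)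
    (h2 : ∫ a, ‖f a‖ ^ 2 ∂(normalizedHaar G) = c)
    (h4 : ∫ a, ‖f a‖ ^ 4 ∂(normalizedHaar G) ≤ 2 * c ^ 2) :
    1 / √2 * √c ≤ ∫ a, ‖f a‖ ∂(normalizedHaar G) := by
  -- The moments are compared through a pointwise inequality in place of Hölder. The polynomial
  -- `3y²/(2r) - y⁴/(2r³)` lies below `y` and touches it at `y = r`; after integration the bound is
  -- `3c/(2r) - c²/r³`, which is largest at `r² = 2c`.
  set r := √(2 * c)
  have hr : 0 < r := Real.sqrt_pos.2 (by positivity)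
  have hr2 : r ^ 2 = 2 * c := Real.sq_sqrt (by positivity)
  have hpt : ∀ y : ℝ, 0 ≤ y → 3 / (2 * r) * y ^ 2 - 1 / (2 * r ^ 3) * y ^ 4 ≤ y := by
    intro y hy
    have : y - (3 / (2 * r) * y ^ 2 - 1 / (2 * r ^ 3) * y ^ 4) =
        y * ((y - r) ^ 2 * (y + 2 * r)) / (2 * r ^ 3) := by
      field_simp
      ring
    have : 0 ≤ y * ((y - r) ^ 2 * (y + 2 * r)) / (2 * r ^ 3) := by positivity
    linarith
  have hint := integral_mono (μ := normalizedHaar G)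
    (f := fun a => 3 / (2 * r) * ‖f a‖ ^ 2 - 1 / (2 * r ^ 3) * ‖f a‖ ^ 4) (g := fun a => ‖f a‖)
    (integrable_normalizedHaar (by fun_prop)) (integrable_normalizedHaar (by fun_prop))
    fun a => hpt _ (norm_nonneg _)
  rw [integral_sub (integrable_normalizedHaar (by fun_prop))
    (integrable_normalizedHaar (by fun_prop)), integral_const_mul, integral_const_mul, h2] at hint
  refine le_trans ?_ hint
  have h5 : 1 / (2 * r ^ 3) * ∫ a, ‖f a‖ ^ 4 ∂(normalizedHaar G) ≤
      1 / (2 * r ^ 3) * (2 * c ^ 2) := by gcongr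
  have h6 : 1 / √2 * √c = r / 2 := by
    rw [show r = √2 * √c from Real.sqrt_mul (by norm_num) c, div_mul_eq_mul_div, one_mul,
      div_eq_div_iff (by positivity) (by norm_num)]
    linear_combination -√c * Real.mul_self_sqrt (show (0 : ℝ) ≤ 2 by norm_num)
  have h7 : 3 / (2 * r) * c - 1 / (2 * r ^ 3) * (2 * c ^ 2) = r / 2 := by
    have : c = r ^ 2 / 2 := by linarith
    rw [this]
    field_simp
    ring
  linarith

/-- For a `Λ(2)`-set the second moment is controlled by the first one. -/
theorem sqrt_card_le_of_mem_lambdaBounds {E : Set (PontryaginDual G)} (hh : Set.InjOn h s)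
    (hE : h '' s ⊆ E) {C : ℝ} (hC : C ∈ lambdaBounds 2 E) :
    √(s.card : ℝ) ≤ C * ∫ a, ‖characterSum s h a‖ ∂(normalizedHaar G) := by
  have hP := hC.2 _ (trigPolynomials_mono hE (characterSum_mem s h))
  have hcont : Continuous fun a => characterSum s h a := map_continuous _
  have hm1 : MemLp (fun a => characterSum s h a) 1 (normalizedHaar G) :=
    memLp_one_iff_integrable.2 (integrable_normalizedHaar hcont)
  have hm2 : MemLp (fun a => characterSum s h a) 2 (normalizedHaar G) :=
    (memLp_two_iff_integrable_sq_norm (integrable_normalizedHaar hcont).1).2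
      (integrable_normalizedHaar (by fun_prop))
  rw [hm2.eLpNorm_eq_integral_rpow_norm (by norm_num) (by norm_num),
    hm1.eLpNorm_eq_integral_rpow_norm (by norm_num) (by norm_num),
    ← ENNReal.ofReal_mul hC.1.le] at hP
  have hnn : 0 ≤ ∫ a, ‖characterSum s h a‖ ∂(normalizedHaar G) :=
    integral_nonneg fun a => norm_nonneg _
  simp only [ENNReal.toReal_ofNat, ENNReal.toReal_one, Real.rpow_one, inv_one,
    Real.rpow_ofNat, integral_norm_sq_characterSum hh] at hP
  rw [ENNReal.ofReal_le_ofReal_iff (mul_nonneg hC.1.le hnn)] at hP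
  rwa [Real.sqrt_eq_rpow, one_div]

/-- The ratio `‖u‖₂ / ‖u‖₁` is a positive lower bound of all admissible constants, hence of their
infimum. Neither attainment nor positivity of the infimum has to be known beforehand. -/
theorem sqrt_card_div_lambdaConstant_le {E : Set (PontryaginDual G)} (hh : Set.InjOn h s)
    (hs : s.Nonempty) (hE : h '' s ⊆ E) (hlam : IsLambdaSet 2 E) :
    1 / lambdaConstant 2 E * √(s.card : ℝ) ≤
      ∫ a, ‖characterSum s h a‖ ∂(normalizedHaar G) := by
  have hcard : 0 < √(s.card : ℝ) := Real.sqrt_pos.2 (by exact_mod_cast hs.card_pos)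
  obtain ⟨C₀, hC₀⟩ := hlam
  have hint : 0 < ∫ a, ‖characterSum s h a‖ ∂(normalizedHaar G) := by
    by_contra! hneg
    have := sqrt_card_le_of_mem_lambdaBounds hh hE hC₀
    nlinarith [hC₀.1]
  have hle : √(s.card : ℝ) / ∫ a, ‖characterSum s h a‖ ∂(normalizedHaar G) ≤
      lambdaConstant 2 E :=
    le_csInf ⟨C₀, hC₀⟩ fun C hC =>
      (div_le_iff₀ hint).2 (sqrt_card_le_of_mem_lambdaBounds hh hE hC)
  have hpos : 0 < lambdaConstant 2 E := (div_pos hcard hint).trans_le hle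
  rw [one_div_mul_eq_div, div_le_iff₀ hpos, mul_comm]
  exact (div_le_iff₀ hint).1 hle

end Moments

/-! ### From the Dirichlet group to the real line -/

section PullBack

variable {ω : ℕ+ → ℝ} {G : Type*} [CommGroup G] [TopologicalSpace G]
  {β : Multiplicative ℝ →ₜ* G}

theorem Circle.eq_of_exp_neg_mul_eq {a b : ℝ}
    (h : ∀ t : ℝ, Circle.exp (-(a * t)) = Circle.exp (-(b * t))) : a = b := by
  by_contra hab
  have hd : a - b ≠ 0 := sub_ne_zero.2 hab
  -- At `t = π / (a - b)` the quotient of the two exponentials is `-1`.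
  have h1 : Circle.exp (-(a * (Real.pi / (a - b)))) * Circle.exp (b * (Real.pi / (a - b))) = 1 := by
    rw [h, ← Circle.exp_add, neg_add_cancel, Circle.exp_zero]
  rw [← Circle.exp_add] at h1
  have h2 : -(a * (Real.pi / (a - b))) + b * (Real.pi / (a - b)) = -Real.pi := by
    field_simp
    ring
  rw [h2] at h1
  have h3 := congrArg (fun z : Circle => (z : ℂ)) h1
  simp only [Circle.coe_exp, Circle.coe_one] at h3
  push_cast at h3
  rw [neg_mul, Complex.exp_neg, Complex.exp_pi_mul_I] at h3
  norm_num at h3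

namespace IsDirichletGroup

theorem char_injective (hω : Function.Injective ω) (hβ : IsDirichletGroup ω β) :
    Function.Injective hβ.char := fun n m hnm =>
  hω (Circle.eq_of_exp_neg_mul_eq fun t => by rw [← hβ.char_apply, ← hβ.char_apply, hnm])

/-- Characters are determined on the dense subgroup `β(ℝ)`, where a multiplicative relation between
them is an additive relation between frequencies. Hence the two forms of the `B₂`-condition agree.
-/
theorem char_mul_char_eq_iff (hβ : IsDirichletGroup ω β) (i j k l : ℕ+) :
    hβ.char i * hβ.char j = hβ.char k * hβ.char l ↔ ω i + ω j = ω k + ω l := by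
  have hval : ∀ (m n : ℕ+) (t : ℝ), (hβ.char m * hβ.char n) (β (Multiplicative.ofAdd t)) =
      Circle.exp (-((ω m + ω n) * t)) := by
    intro m n t
    change hβ.char m _ * hβ.char n _ = _
    rw [hβ.char_apply, hβ.char_apply, ← Circle.exp_add]
    congr 1
    ring
  refine ⟨fun h => Circle.eq_of_exp_neg_mul_eq fun t => by rw [← hval, ← hval, h], fun h => ?_⟩
  refine PontryaginDual.ext fun a => congrFun
    (hβ.denseRange.equalizer (map_continuous _) (map_continuous _) ?_) a
  funext t
  exact (hval i j t.toAdd).trans (by rw [h]; exact (hval k l t.toAdd).symm)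

variable [CompactSpace G]

/-- Pull-back of continuous functions on `G` to bounded continuous functions on `ℝ`. -/
noncomputable def pullback (hβ : IsDirichletGroup ω β) : C(G, ℂ) →ₗᵢ[ℂ] (ℝ →ᵇ ℂ) where
  toFun g := (BoundedContinuousFunction.mkOfCompact g).compContinuous
    ⟨fun t : ℝ => β (Multiplicative.ofAdd t), (map_continuous β).comp continuous_ofAdd⟩
  map_add' _ _ := rfl
  map_smul' _ _ := rfl
  norm_map' g := by
    refine le_antisymm ((BoundedContinuousFunction.norm_le (norm_nonneg g)).2 fun t =>
      g.norm_coe_le_norm _) ((ContinuousMap.norm_le _ (norm_nonneg _)).2 fun a => ?_)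
    refine isClosed_property hβ.denseRange
      (isClosed_le (map_continuous g).norm continuous_const) (fun t => ?_) a
    exact BoundedContinuousFunction.norm_coe_le_norm
      ((BoundedContinuousFunction.mkOfCompact g).compContinuous
        ⟨fun t : ℝ => β (Multiplicative.ofAdd t), (map_continuous β).comp continuous_ofAdd⟩)
      t.toAdd

theorem pullback_apply (hβ : IsDirichletGroup ω β) (g : C(G, ℂ)) (t : ℝ) :
    hβ.pullback g t = g (β (Multiplicative.ofAdd t)) := rfl

theorem pullback_char (hβ : IsDirichletGroup ω β) {J : Finset ℕ+} (n : J) :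
    hβ.pullback (characterFun (hβ.char n)) = HInf.restrictₗᵢ ω J (HInf.monomial ω J n) := by
  ext t
  refine Eq.trans ?_ (HInf.restrict_monomial n t).symm
  rw [pullback_apply, ← Circle.coe_exp, ← hβ.char_apply]
  rfl

/-- Both sides are spanned by the functions `t ↦ e^{-iω_n t}`, `n ∈ J`. As both embeddings are
isometric, this is the Bohr transform between Dirichlet and trigonometric polynomials. -/
theorem map_pullback_trigPolynomials (hβ : IsDirichletGroup ω β) (J : Finset ℕ+) :
    (trigPolynomials (hβ.char '' J)).map hβ.pullback.toLinearMap =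
      LinearMap.range (HInf.restrictₗᵢ ω J).toLinearMap := by
  rw [← Submodule.map_top, ← HInf.span_range_monomial, trigPolynomials, Submodule.map_span,
    Submodule.map_span, ← Set.range_comp]
  congr 1
  ext f
  constructor
  · rintro ⟨_, ⟨_, ⟨n, hn, rfl⟩, rfl⟩, rfl⟩
    exact ⟨⟨n, hn⟩, (hβ.pullback_char ⟨n, hn⟩).symm⟩
  · rintro ⟨n, rfl⟩
    exact ⟨_, ⟨_, ⟨n, n.2, rfl⟩, rfl⟩, hβ.pullback_char n⟩

/-- The projection constant of `H_∞^J(ω)` is at least the `L₁`-norm of the sum of the characters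
`h_{ω_n}`, `n ∈ J`, on any `ω`-Dirichlet group. -/
theorem integral_norm_characterSum_le_projectionConstant [IsTopologicalGroup G]
    [MeasurableSpace G] [BorelSpace G] (hω : Function.Injective ω) (hβ : IsDirichletGroup ω β)
    (J : Finset ℕ+) :
    ENNReal.ofReal (∫ a, ‖characterSum J hβ.char a‖ ∂(normalizedHaar G)) ≤
      projectionConstant (HInf ω J) := by
  set X := LinearMap.range (HInf.restrictₗᵢ ω J).toLinearMap
  have hX : FiniteDimensional ℂ X := inferInstance
  have hcompl : X.ClosedComplemented := Submodule.ClosedComplemented.of_finiteDimensional X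
  -- The test space is `ℝ →ᵇ ℂ` rather than `C(G, ℂ)`: it lies in the universe of `HInf ω J`, while
  -- `G` may live in any universe.
  refine le_trans ?_ (le_iSup_of_le (ℝ →ᵇ ℂ) <| le_iSup_of_le inferInstance <|
    le_iSup_of_le inferInstance <| le_iSup_of_le inferInstance <|
    le_iSup_of_le (HInf.restrictₗᵢ ω J) <| le_iSup_of_le hcompl le_rfl)
  refine le_iInf₂ fun P hP => ?_
  rw [← ofReal_norm]
  refine ENNReal.ofReal_le_ofReal ?_
  have hmap := hβ.map_pullback_trigPolynomials J
  have hrange : ∀ f : X, ∃ g ∈ trigPolynomials (hβ.char '' J), hβ.pullback g = f := fun f =>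
    (Submodule.mem_map.1 (hmap.symm ▸ f.2 : (f : ℝ →ᵇ ℂ) ∈ Submodule.map _ _))
  have hXle : X ≤ hβ.pullback.range := fun f hf => by
    obtain ⟨g, -, hg⟩ := hrange ⟨f, hf⟩
    exact ⟨g, hg⟩
  -- `P` maps into `X`, which lies in the range of the pull-back, so `P` composed with the pull-back
  -- can be transported back to `C(G, ℂ)`.
  let R : C(G, ℂ) →L[ℂ] C(G, ℂ) :=
    (hβ.pullback.equivRange.symm.toContinuousLinearEquiv : hβ.pullback.range →L[ℂ] C(G, ℂ)).comp
      (((X.subtypeL.comp P).comp hβ.pullback.toContinuousLinearMap).codRestrict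
        hβ.pullback.range fun g => hXle (P (hβ.pullback g)).2)
  have hR : ∀ g, hβ.pullback (R g) = P (hβ.pullback g) := fun g =>
    congrArg Subtype.val (hβ.pullback.equivRange.apply_symm_apply
      ⟨(P (hβ.pullback g) : ℝ →ᵇ ℂ), hXle (P (hβ.pullback g)).2⟩)
  have hRnorm : ‖R‖ ≤ ‖P‖ := ContinuousLinearMap.opNorm_le_bound _ (norm_nonneg P) fun g => by
    rw [← hβ.pullback.norm_map (R g), hR, ← hβ.pullback.norm_map g]
    exact P.le_opNorm _
  refine le_trans (integral_norm_characterSum_le ((hβ.char_injective hω).injOn) R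
    (fun g => ?_) fun g hg => ?_) hRnorm
  · obtain ⟨g', hg', h⟩ := hrange (P (hβ.pullback g))
    rw [← hR] at h
    rwa [← hβ.pullback.injective h]
  · refine hβ.pullback.injective ?_
    rw [hR]
    have hmem : hβ.pullback g ∈ X := hmap.le (Submodule.mem_map_of_mem hg)
    exact congrArg Subtype.val (hP ⟨_, hmem⟩)

/-- The lower bound for frequencies satisfying the `B₂`-condition. -/
theorem sqrt_half_le_projectionConstant [IsTopologicalGroup G] (hω : Function.Injective ω)
    (hβ : IsDirichletGroup ω β) (hB : SatisfiesB2 ω) {J : Finset ℕ+} (hJ : J.Nonempty) :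
    ENNReal.ofReal (1 / √2 * √(J.card : ℝ)) ≤ projectionConstant (HInf ω J) := by
  borelize G
  have hinj : Set.InjOn hβ.char J := (hβ.char_injective hω).injOn
  refine le_trans (ENNReal.ofReal_le_ofReal ?_)
    (hβ.integral_norm_characterSum_le_projectionConstant hω J)
  refine sqrt_half_le_integral_norm (by exact_mod_cast hJ.card_pos)
    (integral_norm_sq_characterSum hinj) (integral_norm_pow_four_characterSum_le ?_)
  intro i _ j _ k _ l _ h
  rw [char_mul_char_eq_iff] at h
  have := (hB _ ⟨i, rfl⟩ _ ⟨j, rfl⟩ _ ⟨k, rfl⟩ _ ⟨l, rfl⟩).1 (congrArg Multiplicative.ofAdd h)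
  simpa [hω.eq_iff] using this

end IsDirichletGroup

theorem IsDirichletGroup.satisfiesB2 (hω : Function.Injective ω) (hβ : IsDirichletGroup ω β)
    (hB : IsB2Set (Set.range hβ.char)) : SatisfiesB2 ω := by
  rintro _ ⟨i, rfl⟩ _ ⟨j, rfl⟩ _ ⟨k, rfl⟩ _ ⟨l, rfl⟩
  have h := hB _ ⟨i, rfl⟩ _ ⟨j, rfl⟩ _ ⟨k, rfl⟩ _ ⟨l, rfl⟩
  rw [hβ.char_mul_char_eq_iff] at h
  simpa [(hβ.char_injective hω).eq_iff, hω.eq_iff, ← ofAdd_add] using h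

end PullBack

/-! ### Existence of a Dirichlet group for every frequency -/

section TorusDirichletGroup

/-- The one-parameter subgroup `t ↦ (e^{-iω_n t})_n` of the infinite torus. -/
noncomputable def torusFlow (ω : ℕ+ → ℝ) : Multiplicative ℝ →* (ℕ+ → Circle) where
  toFun t := fun n => Circle.exp (-(ω n * t.toAdd))
  map_one' := by ext; simp
  map_mul' s t := by
    funext n
    rw [Pi.mul_apply, ← Circle.exp_add, toAdd_mul]
    congr 1
    ring

theorem continuous_torusFlow (ω : ℕ+ → ℝ) : Continuous (torusFlow ω) :=
  continuous_pi fun _ => Circle.exp.continuous.comp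
    ((continuous_const.mul continuous_toAdd).neg)

/-- The closure of the one-parameter subgroup in the torus, a compact abelian group. -/
abbrev TorusDirichletGroup (ω : ℕ+ → ℝ) : Type :=
  (torusFlow ω).range.topologicalClosure

instance (ω : ℕ+ → ℝ) : CompactSpace (TorusDirichletGroup ω) :=
  isCompact_iff_compactSpace.1 (Subgroup.isClosed_topologicalClosure _).isCompact

/-- The dense one-parameter subgroup of `TorusDirichletGroup ω`. -/
noncomputable def torusDirichletHom (ω : ℕ+ → ℝ) :
    Multiplicative ℝ →ₜ* TorusDirichletGroup ω where
  toMonoidHom := (torusFlow ω).codRestrict _ fun t =>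
    Subgroup.le_topologicalClosure _ ⟨t, rfl⟩
  continuous_toFun := (continuous_torusFlow ω).subtype_mk _

/-- The characters are the coordinate projections. This supplies a group for the form of the
`B₂`-condition that mentions only `ω`. -/
theorem isDirichletGroup_torus (ω : ℕ+ → ℝ) : IsDirichletGroup ω (torusDirichletHom ω) where
  denseRange := fun a => by
    rw [closure_subtype, ← Set.range_comp]
    exact a.2
  exists_char := fun n => by
    let h : TorusDirichletGroup ω →ₜ* Circle :=
      { toMonoidHom := (Pi.evalMonoidHom (fun _ : ℕ+ => Circle) n).comp (Subgroup.subtype _)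
        continuous_toFun := (continuous_apply n).comp continuous_subtype_val }
    exact ⟨h, fun t => rfl⟩

end TorusDirichletGroup

theorem card_Icc_one_pnat (x : ℕ+) : ((Finset.Icc 1 x).card : ℝ) = (x : ℝ) := by
  simp [PNat.card_Icc]

theorem theorem2p8 (ω : ℕ+ → ℝ) (hω : IsFrequency ω) :
    (∀ (G : Type*) [CommGroup G] [TopologicalSpace G] [IsTopologicalGroup G] [CompactSpace G]
        [T2Space G] [MeasurableSpace G] [BorelSpace G]
        (β : Multiplicative ℝ →ₜ* G) (hβ : IsDirichletGroup ω β),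
      IsLambdaSet 2 (Set.range hβ.char) →
      ∀ x : ℕ+,
        ENNReal.ofReal (1 / lambdaConstant 2 (Set.range hβ.char) * √(x : ℝ)) ≤
            projectionConstant (HInfLE ω x) ∧
          projectionConstant (HInfLE ω x) ≤ ENNReal.ofReal √(x : ℝ)) ∧
    (∀ (G : Type*) [CommGroup G] [TopologicalSpace G] [IsTopologicalGroup G] [CompactSpace G]
        [T2Space G]
        (β : Multiplicative ℝ →ₜ* G) (hβ : IsDirichletGroup ω β),
      IsB2Set (Set.range hβ.char) →
      ∀ x : ℕ+,
        ENNReal.ofReal (1 / √2 * √(x : ℝ)) ≤ projectionConstant (HInfLE ω x) ∧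
          projectionConstant (HInfLE ω x) ≤ ENNReal.ofReal √(x : ℝ)) ∧
    (SatisfiesB2 ω →
      ∀ x : ℕ+,
        ENNReal.ofReal (1 / √2 * √(x : ℝ)) ≤ projectionConstant (HInfLE ω x) ∧
          projectionConstant (HInfLE ω x) ≤ ENNReal.ofReal √(x : ℝ)) := by 
  have hinj := hω.strictMono.injective
  have hupper : ∀ x : ℕ+, projectionConstant (HInfLE ω x) ≤ ENNReal.ofReal √(x : ℝ) := fun x => by
    simpa only [card_Icc_one_pnat] using HInf.projectionConstant_le hinj (Finset.Icc 1 x)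
  have hne : ∀ x : ℕ+, (Finset.Icc 1 x).Nonempty := fun x => ⟨1, by simp⟩
  refine ⟨?_, ?_, ?_⟩
  · intro G _ _ _ _ _ _ _ β hβ hlam x
    refine ⟨le_trans (ENNReal.ofReal_le_ofReal ?_)
      (hβ.integral_norm_characterSum_le_projectionConstant hinj (Finset.Icc 1 x)), hupper x⟩
    simpa only [card_Icc_one_pnat] using sqrt_card_div_lambdaConstant_le
      (hβ.char_injective hinj).injOn (hne x) (Set.image_subset_range _ _) hlam
  · intro G _ _ _ _ _ β hβ hB x
    refine ⟨?_, hupper x⟩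
    simpa only [card_Icc_one_pnat] using
      hβ.sqrt_half_le_projectionConstant hinj (hβ.satisfiesB2 hinj hB) (hne x)
  · intro hB x
    refine ⟨?_, hupper x⟩
    simpa only [card_Icc_one_pnat] using
      (isDirichletGroup_torus ω).sqrt_half_le_projectionConstant hinj hB (hne x)
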